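/- Let $\nu$ be an infinite regular cardinal and let $\mu=\nu^+$. Write ${}^{<\omega}\mu$ for the set of finite sequences of ordinals below $\mu$, $\ell(\varrho)$ for the length of $\varrho$, $\mathrm{Im}(\varrho)$ for the set of its entries, ${}^\frown$ for concatenation, $\sqsubseteq$ for "is an initial segment of", and $E^\mu_\nu=\{\alpha<\mu\mid \mathrm{cf}(\alpha)=\nu\}$. Then there exist a map $d_0:{}^{<\omega}\mu\to\omega$ and an ideal $J$ on $\mu$ such that: (i) $J$ contains every subset of $\mu$ of cardinality less than $\mu$; $J$ is $\mu$-additive, i.e. closed under unions of fewer than $\mu$ of its members; $J$ is normal, i.e. for every sequence $\langle A_i\mid i<\mu\rangle$ of members of $J$, the diagonal union $\{\beta<\mu\mid \exists i<\beta\ (\beta\in A_i)\}$ is in $J$; and $E^\mu_\nu\notin J$ (in particular, $J$ is proper); (ii) for every $A\subseteq\mu$ with $A\notin J$, and every sequence $\langle(u_\alpha,v_\alpha,\sigma_\alpha)\mid\alpha\in A\rangle$ such that, for every $\alpha\in A$, - $u_\alpha$ and $v_\alpha$ are nonempty subsets of ${}^{<\omega}\mu$ of cardinality less than $\nu$, and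 $\sigma_\alpha\in{}^{<\omega}\mu$, - $\alpha\in\mathrm{Im}(\varrho)$ for all $\varrho\in u_\alpha$, - $\sigma_\alpha{}^\frown\langle\alpha\rangle\sqsubseteq\sigma$ for all $\sigma\in v_\alpha$, there exist $\alpha<\beta$, both in $A$, such that $d_0(\varrho{}^\frown\sigma)=\ell(\varrho)$ for all $\varrho\in u_\alpha$ and all $\sigma\in v_\beta$. -/

import Mathlib

universe u

/-- The ordinals below the cardinal `μ`, i.e. the (von Neumann) cardinal `μ` as a set of ordinals. -/
abbrev Below (μ : Cardinal.{u}) : Type (u + 1) := Set.Iio μ.ord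

/-- The set of all `α < μ` of cofinality `ν`. -/
def cofSet (μ ν : Cardinal.{u}) : Set (Below μ) :=
  {α | (α : Ordinal.{u}).cof = ν}

/-- `J` contains every subset of `μ` of cardinality less than `μ`. -/
def ContainsSmallSets {μ : Cardinal.{u}} (J : Order.Ideal (Set (Below μ))) : Prop :=
  ∀ B : Set (Below μ), Cardinal.mk B < Cardinal.lift.{u + 1} μ → B ∈ J

/-- `J` is `μ`-additive: closed under unions of fewer than `μ` of its members. -/
def IsAdditiveIdeal {μ : Cardinal.{u}} (J : Order.Ideal (Set (Below μ))) : Prop :=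
  ∀ S : Set (Set (Below μ)), Cardinal.mk S < Cardinal.lift.{u + 1} μ →
    (∀ A ∈ S, A ∈ J) → ⋃₀ S ∈ J

/-- The diagonal union of a sequence of `μ` many subsets of `μ`. -/
def diagonalUnion {μ : Cardinal.{u}} (A : Below μ → Set (Below μ)) : Set (Below μ) :=
  {β | ∃ i, i < β ∧ β ∈ A i}

/-- `J` is normal: closed under diagonal unions. -/
def IsNormalIdeal {μ : Cardinal.{u}} (J : Order.Ideal (Set (Below μ))) : Prop :=
  ∀ A : Below μ → Set (Below μ), (∀ i, A i ∈ J) → diagonalUnion A ∈ J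

/-- The requirements on a sequence `⟨(u α, v α, σ α) ∣ α ∈ A⟩`; elements of `List (Below μ)` are
the finite sequences of ordinals below `μ`, and `<+:` is "is an initial segment of". -/
structure IsOscSequence {μ : Cardinal.{u}} (ν : Cardinal.{u}) (A : Set (Below μ))
    (u v : A → Set (List (Below μ))) (σ : A → List (Below μ)) : Prop where
  u_nonempty : ∀ α, (u α).Nonempty
  v_nonempty : ∀ α, (v α).Nonempty
  u_small : ∀ α, Cardinal.mk (u α) < Cardinal.lift.{u + 1} ν
  v_small : ∀ α, Cardinal.mk (v α) < Cardinal.lift.{u + 1} ν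
  mem_of_mem_u : ∀ α : A, ∀ ρ ∈ u α, (α : Below μ) ∈ ρ
  prefix_of_mem_v : ∀ α : A, ∀ τ ∈ v α, σ α ++ [(α : Below μ)] <+: τ

-- Fix for each `y < μ` of cofinality `ν` a cofinal ladder of length `ν`; the rung of `z < y` is the
-- index of the first ladder term not below `z`. Consider the entries of `ϱ⌢σ` in the order of `μ`.
-- If one pair of neighbours, with upper end `β`, has a rung exceeding those of all other
-- neighbours, then `β` can be read off from the word, and so can `α`, as the least entry below `β`
-- with that same rung. A coloring of the pair `(α, β)` supplies the first position of `β` in `σ`;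
-- subtracting it from the first position of `β` in the whole word gives `ℓ(ϱ)`
-- (`cutDecode_append`). Normality and additivity of the ideal make the competing rungs small
-- (`exists_decoding`). It remains to find a coloring that takes every value on each positive set,
-- on pairs with arbitrarily large rung (`exists_isGoodColoring`). If `2^κ ≤ ν` for all `κ < ν`, the
-- ideal is the nonstationary ideal restricted to cofinality `ν`; the coloring reads a countable
-- stationary partition at a point located through the first difference of two of `μ ≤ 2^ν` binary
-- sequences. Otherwise there are `ν` binary sequences of a length `< ν` with fewer than `ν` proper
-- initial segments. The color then depends on `y` and on where the sequence indexed by the rung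
-- splits from a fixed one, and positivity is defined so that all colors occur.

universe v

open Cardinal Set

/-- `X` is a well-order of the successor type of the regular cardinal type of `K`, as far as the
sizes of initial segments can tell. -/
structure IsSuccPair (X K : Type v) [LinearOrder X] [LinearOrder K] : Prop where
  regular : (#K).IsRegular
  mk_Iio_lt : ∀ k : K, #(Iio k) < #K
  mk_Iio_le : ∀ x : X, #(Iio x) ≤ #K
  mk_lt : #K < #X

/-- The points of `X` of cofinality `#K`. -/
def ladderPoints (X K : Type v) [LinearOrder X] : Set X :=
  {y | (∃ c : K → X, (∀ i, c i < y) ∧ ∀ z < y, ∃ i, z ≤ c i) ∧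
    ∀ S : Set X, S ⊆ Iio y → #S < #K → ∃ b < y, ∀ s ∈ S, s < b}

/-- The points of `X` closed under the function `g`. -/
def closedPts {X : Type v} [LinearOrder X] (g : X → X) : Set X :=
  {y | ∀ x < y, g x < y}

theorem closedPts_anti {X : Type v} [LinearOrder X] {g g' : X → X} (h : ∀ x, g x ≤ g' x) :
    closedPts g' ⊆ closedPts g := fun _ hy x hx => (h x).trans_lt (hy x hx)

/-! ### Bounding and closure arguments in a successor cardinal. -/

namespace IsSuccPair

variable {X K : Type v} [LinearOrder X] [LinearOrder K]

theorem aleph0_le (hP : IsSuccPair X K) : ℵ₀ ≤ #K := hP.regular.aleph0_le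

theorem mk_Iic_lt (hP : IsSuccPair X K) (k : K) : #(Iic k) < #K := by
  rw [← Iio_insert]
  exact (mk_insert_le).trans_lt
    (add_lt_of_lt hP.aleph0_le (hP.mk_Iio_lt k) (one_lt_aleph0.trans_le hP.aleph0_le))

theorem mk_Iic_le (hP : IsSuccPair X K) (x : X) : #(Iic x) ≤ #K := by
  rw [← Iio_insert]
  exact mk_insert_le.trans
    (add_le_of_le hP.aleph0_le (hP.mk_Iio_le x) (one_le_aleph0.trans hP.aleph0_le))

theorem mk_iUnion_le {ι Y : Type v} (hP : IsSuccPair X K) {f : ι → Set Y} (hι : #ι ≤ #K)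
    (hf : ∀ i, #(f i) ≤ #K) : #(⋃ i, f i) ≤ #K :=
  (Cardinal.mk_iUnion_le f).trans
    ((mul_le_mul' hι (ciSup_le' hf)).trans (mul_eq_self hP.aleph0_le).le)

theorem exists_gt (hP : IsSuccPair X K) (S : Set X) (hS : #S ≤ #K) : ∃ b, ∀ s ∈ S, s < b := by
  by_contra! h
  have : (⋃ s : S, Iic (s : X)) = Set.univ := by
    ext b
    obtain ⟨s, hs, hb⟩ := h b
    simpa using ⟨s, hs, hb⟩
  have h2 := hP.mk_iUnion_le (f := fun s : S => Iic (s : X)) hS fun s => hP.mk_Iic_le _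
  rw [this, mk_univ] at h2
  exact absurd hP.mk_lt h2.not_gt

theorem exists_gt_index (hP : IsSuccPair X K) (S : Set K) (hS : #S < #K) :
    ∃ b, ∀ s ∈ S, s < b := by
  by_contra! h
  have : (⋃ s : S, Iic (s : K)) = Set.univ := by
    ext b
    obtain ⟨s, hs, hb⟩ := h b
    simpa using ⟨s, hs, hb⟩
  have h2 := (card_iUnion_lt_iff_forall_of_isRegular (t := fun s : S => Iic (s : K))
    hP.regular hS).2 fun s => hP.mk_Iic_lt _
  rw [this, mk_univ] at h2
  exact h2.false

theorem exists_gt_elem (hP : IsSuccPair X K) (k : K) : ∃ b, k < b := by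
  obtain ⟨b, hb⟩ := hP.exists_gt_index {k} (by simpa using one_lt_aleph0.trans_le hP.aleph0_le)
  exact ⟨b, hb k rfl⟩

theorem nonempty_index (hP : IsSuccPair X K) : Nonempty K := by
  rw [← mk_ne_zero_iff]
  exact (aleph0_pos.trans_le hP.aleph0_le).ne'

theorem exists_ge_family (hP : IsSuccPair X K) {ι : Type v} (hι : #ι ≤ #K) (g : ι → X → X) :
    ∃ g' : X → X, ∀ i x, g i x ≤ g' x := by
  have h : ∀ x, ∃ b, ∀ i, g i x < b := fun x => by
    obtain ⟨b, hb⟩ := hP.exists_gt (range fun i => g i x) (mk_range_le.trans hι)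
    exact ⟨b, fun i => hb _ ⟨i, rfl⟩⟩
  choose g' hg' using h
  exact ⟨g', fun i x => (hg' x i).le⟩

theorem exists_ge_diagonal (hP : IsSuccPair X K) (g : X → X → X) :
    ∃ g' : X → X, ∀ i x z, i ≤ z → x ≤ z → g i x ≤ g' z := by
  have h : ∀ z, ∃ b, ∀ i ≤ z, ∀ x ≤ z, g i x < b := fun z => by
    obtain ⟨b, hb⟩ := hP.exists_gt (⋃ i : Iic z, range fun x : Iic z => g i x)
      (hP.mk_iUnion_le (hP.mk_Iic_le z) fun i => mk_range_le.trans (hP.mk_Iic_le z))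
    exact ⟨b, fun i hi x hx => hb _ (mem_iUnion.2 ⟨⟨i, hi⟩, ⟨⟨x, hx⟩, rfl⟩⟩)⟩
  choose g' hg' using h
  exact ⟨g', fun i x z hi hx => (hg' z i hi x hx).le⟩

/-- A sequence indexed by `K` which chooses each term above the preceding ones. -/
theorem exists_seq [WellFoundedLT K] {Y : Type v} (R : Set Y → Y → Prop)
    (hR : ∀ S : Set Y, #S ≤ #K → ∃ y, R S y) (hK : ∀ k : K, #(Iio k) ≤ #K) :
    ∃ b : K → Y, ∀ i, R (b '' Iio i) (b i) := by
  classical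
  have hne : Nonempty Y := (hR ∅ (by simp)).nonempty
  have hR' : ∀ S : Set Y, ∃ y, #S ≤ #K → R S y := fun S => by
    by_cases h : #S ≤ #K
    · obtain ⟨y, hy⟩ := hR S h
      exact ⟨y, fun _ => hy⟩
    · exact ⟨hne.some, fun h' => absurd h' h⟩
  choose N hN using hR'
  let b : K → Y := (wellFounded_lt (α := K)).fix fun i ih => N (range fun j : Iio i => ih j j.2)
  refine ⟨b, fun i => ?_⟩
  have hb : b i = N (b '' Iio i) := by
    rw [image_eq_range]
    exact WellFounded.fix_eq _ _ i
  rw [hb]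
  exact hN _ (mk_image_le.trans (hK i))

/-- The point is the supremum of an increasing `K`-sequence in which every term exceeds the values
of `g` up to each earlier term; regularity of `#K` gives the bounds for small sets. -/
theorem exists_mem_closedPts [WellFoundedLT X] [WellFoundedLT K] (hP : IsSuccPair X K)
    (g : X → X) (b₀ : X) : ∃ y ∈ ladderPoints X K ∩ closedPts g, b₀ < y := by
  obtain ⟨b, hb⟩ := exists_seq (K := K) (Y := X)
    (fun S z => b₀ < z ∧ ∀ s ∈ S, s < z ∧ ∀ x ≤ s, g x < z) (fun S hS => by
      obtain ⟨z, hz⟩ := hP.exists_gt (⋃ s : S, insert b₀ (insert (s : X) (g '' Iic (s : X))))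
        (hP.mk_iUnion_le hS fun s => by
          refine mk_insert_le.trans (add_le_of_le hP.aleph0_le (mk_insert_le.trans
            (add_le_of_le hP.aleph0_le (mk_image_le.trans (hP.mk_Iic_le _)) ?_)) ?_) <;>
          exact one_le_aleph0.trans hP.aleph0_le)
      obtain ⟨z', hz'⟩ := hP.exists_gt {b₀, z}
        ((Set.toFinite _).lt_aleph0.le.trans hP.aleph0_le)
      refine ⟨z', hz' _ (by simp), fun s hs => ?_⟩
      have h : z < z' := hz' _ (by simp)
      refine ⟨(hz s (mem_iUnion.2 ⟨⟨s, hs⟩, by simp⟩)).trans h, fun x hx =>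
        (hz _ (mem_iUnion.2 ⟨⟨s, hs⟩, ?_⟩)).trans h⟩
      exact mem_insert_of_mem _ (mem_insert_of_mem _ ⟨x, hx, rfl⟩)) fun k => (hP.mk_Iio_lt k).le
  have hmono : ∀ i j, i < j → b i < b j := fun i j hij => ((hb j).2 _ ⟨i, hij, rfl⟩).1
  obtain ⟨y₀, hy₀⟩ := hP.exists_gt (range b) mk_range_le
  let U : Set X := {y | ∀ i, b i < y}
  have hU : U.Nonempty := ⟨y₀, fun i => hy₀ _ ⟨i, rfl⟩⟩
  let y := wellFounded_lt.min U hU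
  have hy : ∀ i, b i < y := wellFounded_lt.min_mem U hU
  have hcof : ∀ z < y, ∃ i, z ≤ b i := fun z hz => by
    by_contra! h
    exact wellFounded_lt.not_lt_min U h hz
  obtain ⟨i₀⟩ := hP.nonempty_index
  refine ⟨y, ⟨⟨⟨b, hy, hcof⟩, fun S hS hcard => ?_⟩, fun x hx => ?_⟩, (hb i₀).1.trans (hy i₀)⟩
  · choose i hi using fun s : S => hcof s (hS s.2)
    obtain ⟨k, hk⟩ := hP.exists_gt_index (range i) (mk_range_le.trans_lt hcard)
    exact ⟨b k, hy k, fun s hs => (hi ⟨s, hs⟩).trans_lt (hmono _ _ (hk _ ⟨⟨s, hs⟩, rfl⟩))⟩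
  · obtain ⟨i, hi⟩ := hcof x hx
    obtain ⟨j, hj⟩ := hP.exists_gt_elem i
    exact (((hb j).2 _ ⟨i, hj, rfl⟩).2 x hi).trans (hy j)

end IsSuccPair

/-! ### The normal ideal attached to a local predicate. -/

section Ideal

variable {X K : Type v} [LinearOrder X] [LinearOrder K]

/-- The predicate `T` depends only on the closed points of `g` close to `y`. -/
def IsLocalPred (T : (X → X) → X → Prop) : Prop :=
  ∀ g g' i y, i < y → (∀ x, i < x → x ∈ closedPts g' → x ∈ closedPts g) → T g' y → T g y

/-- The family of all sets `A` such that, for some `g`, no point of `A` of cofinality `#K` closed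
under `g` satisfies `T g`. -/
def avoidingSets (K : Type v) (T : (X → X) → X → Prop) : Set (Set X) :=
  {A | ∃ g : X → X, ∀ y ∈ A, y ∈ ladderPoints X K → y ∈ closedPts g → ¬ T g y}

theorem ladderPoints.exists_lt {y : X} (hP : IsSuccPair X K) (hy : y ∈ ladderPoints X K) :
    ∃ b, b < y := by
  obtain ⟨b, hb, -⟩ := hy.2 ∅ (empty_subset _) (by simpa using aleph0_pos.trans_le hP.aleph0_le)
  exact ⟨b, hb⟩

variable {T : (X → X) → X → Prop}

theorem sUnion_mem_avoidingSets (hP : IsSuccPair X K) (hT : IsLocalPred T) (S : Set (Set X))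
    (hS : #S ≤ #K) (h : ∀ A ∈ S, A ∈ avoidingSets K T) : ⋃₀ S ∈ avoidingSets K T := by
  choose g hg using fun A : S => h A A.2
  obtain ⟨g', hg'⟩ := hP.exists_ge_family hS g
  refine ⟨g', fun y hy hyE hyc hTy => ?_⟩
  obtain ⟨A, hA, hyA⟩ := hy
  obtain ⟨i, hi⟩ := ladderPoints.exists_lt hP hyE
  exact hg ⟨A, hA⟩ y hyA hyE (closedPts_anti (hg' ⟨A, hA⟩) hyc)
    (hT _ _ i y hi (fun x _ hx => closedPts_anti (hg' ⟨A, hA⟩) hx) hTy)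

omit [LinearOrder K] in
theorem avoidingSets_mono {A B : Set X} (hAB : A ⊆ B) (hB : B ∈ avoidingSets K T) :
    A ∈ avoidingSets K T := by
  obtain ⟨g, hg⟩ := hB
  exact ⟨g, fun y hy => hg y (hAB hy)⟩

theorem isIdeal_avoidingSets (hP : IsSuccPair X K) (hT : IsLocalPred T) :
    Order.IsIdeal (avoidingSets K T) where
  IsLowerSet := fun _ _ hAB hA => avoidingSets_mono hAB hA
  Nonempty := ⟨∅, id, by simp⟩
  Directed := fun A hA B hB => by
    refine ⟨⋃₀ {A, B}, sUnion_mem_avoidingSets hP hT _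
      ((Set.toFinite _).lt_aleph0.le.trans hP.aleph0_le) ?_, ?_, ?_⟩
    · rintro C (rfl | rfl) <;> assumption
    · exact subset_sUnion_of_mem (by simp)
    · exact subset_sUnion_of_mem (by simp)

/-- Above `i`, the closed points of a diagonal bound `g'` are closed under `g i`. Locality is what
lets `T g' y` pass to `T (g i) y` although nothing is known up to `i`. -/
theorem diagonal_mem_avoidingSets (hP : IsSuccPair X K) (hT : IsLocalPred T) (A : X → Set X)
    (h : ∀ i, A i ∈ avoidingSets K T) : {y | ∃ i, i < y ∧ y ∈ A i} ∈ avoidingSets K T := by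
  choose g hg using h
  obtain ⟨g', hg'⟩ := hP.exists_ge_diagonal g
  have key : ∀ i x, i < x → x ∈ closedPts g' → x ∈ closedPts (g i) := fun i x hi hx z hz =>
    (hg' i z (max i z) (le_max_left _ _) (le_max_right _ _)).trans_lt (hx _ (max_lt hi hz))
  refine ⟨g', fun y hy hyE hyc hTy => ?_⟩
  obtain ⟨i, hi, hyA⟩ := hy
  exact hg i y hyA hyE (key i y hi hyc) (hT _ _ i y hi (key i) hTy)

theorem small_mem_avoidingSets (hP : IsSuccPair X K) (B : Set X) (hB : #B ≤ #K) :
    B ∈ avoidingSets K T := by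
  obtain ⟨b, hb⟩ := hP.exists_gt B hB
  refine ⟨fun _ => b, fun y hy hyE hyc => ?_⟩
  obtain ⟨i, hi⟩ := ladderPoints.exists_lt hP hyE
  exact absurd (hb y hy) (hyc i hi).not_gt

theorem exists_fiber_notMem (hP : IsSuccPair X K) (hT : IsLocalPred T) {A : Set X}
    (hA : A ∉ avoidingSets K T) {ι : Type v} (hι : #ι ≤ #K) (f : X → ι) :
    ∃ i, {x ∈ A | f x = i} ∉ avoidingSets K T := by
  by_contra! h
  refine hA (avoidingSets_mono ?_ (sUnion_mem_avoidingSets hP hT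
    (range fun i => {x ∈ A | f x = i}) (mk_range_le.trans hι) ?_))
  · exact fun x hx => ⟨_, ⟨f x, rfl⟩, hx, rfl⟩
  · rintro _ ⟨i, rfl⟩
    exact h i

/-- Fodor's lemma: normality in its regressive-function form. -/
theorem exists_fiber_notMem_of_lt (hP : IsSuccPair X K) (hT : IsLocalPred T) {A : Set X}
    (hA : A ∉ avoidingSets K T) (f : X → X) (hf : ∀ x ∈ A, f x < x) :
    ∃ i, {x ∈ A | f x = i} ∉ avoidingSets K T := by
  by_contra! h
  refine hA (avoidingSets_mono ?_ (diagonal_mem_avoidingSets hP hT _ h))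
  exact fun x hx => ⟨f x, hf x hx, hx, rfl⟩

omit [LinearOrder K] in
theorem inter_ladderPoints_notMem {A : Set X} (hA : A ∉ avoidingSets K T) :
    A ∩ ladderPoints X K ∉ avoidingSets K T := fun ⟨g, hg⟩ =>
  hA ⟨g, fun y hy hyE => hg y ⟨hy, hyE⟩ hyE⟩

theorem exists_gt_of_notMem_avoidingSets (hP : IsSuccPair X K) {A : Set X}
    (hA : A ∉ avoidingSets K T) (b : X) : ∃ a ∈ A, b < a := by
  by_contra! h
  exact hA (small_mem_avoidingSets hP A ((mk_le_mk_of_subset h).trans (hP.mk_Iic_le b)))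

end Ideal

/-! ### Ladder systems and rungs. -/

section Rung

variable {X K : Type v} [LinearOrder X] [LinearOrder K] [WellFoundedLT K]

/-- `c` assigns to every point of cofinality `#K` a cofinal sequence. -/
def IsLadderSystem (c : X → K → X) : Prop :=
  ∀ y ∈ ladderPoints X K, (∀ i, c y i < y) ∧ ∀ z < y, ∃ i, z ≤ c y i

omit [LinearOrder K] [WellFoundedLT K] in
theorem exists_isLadderSystem [Nonempty X] : ∃ c : X → K → X, IsLadderSystem c := by
  classical
  have : ∀ y : X, ∃ c : K → X, y ∈ ladderPoints X K →
      (∀ i, c i < y) ∧ ∀ z < y, ∃ i, z ≤ c i := fun y => by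
    by_cases h : y ∈ ladderPoints X K
    · obtain ⟨c, hc⟩ := h.1
      exact ⟨c, fun _ => hc⟩
    · exact ⟨fun _ => y, fun h' => absurd h' h⟩
  choose c hc using this
  exact ⟨c, hc⟩

open Classical in
/-- The least `i` such that the `i`-th term of the sequence of `y` is at least `z`. -/
noncomputable def rung [Nonempty K] (c : X → K → X) (z y : X) : K :=
  if h : {i | z ≤ c y i}.Nonempty then wellFounded_lt.min _ h else Classical.arbitrary K

variable [Nonempty K] {c : X → K → X} {x y z : X}

theorem le_rung_term (hc : IsLadderSystem c) (hy : y ∈ ladderPoints X K) (hz : z < y) :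
    z ≤ c y (rung c z y) := by
  have h : {i | z ≤ c y i}.Nonempty := (hc y hy).2 z hz
  rw [rung, dif_pos h]
  exact wellFounded_lt.min_mem _ h

theorem rung_le {i : K} (h : z ≤ c y i) : rung c z y ≤ i := by
  have h' : {i | z ≤ c y i}.Nonempty := ⟨i, h⟩
  rw [rung, dif_pos h']
  exact not_lt.1 (wellFounded_lt.not_lt_min {i | z ≤ c y i} h)

theorem term_lt_of_lt_rung {i : K} (h : i < rung c z y) : c y i < z := by
  by_contra! h'
  exact absurd (rung_le h') h.not_ge

theorem rung_mono (hc : IsLadderSystem c) (hy : y ∈ ladderPoints X K) (hxz : x ≤ z) (hz : z < y) :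
    rung c x y ≤ rung c z y := rung_le (hxz.trans (le_rung_term hc hy hz))

/-- Every index is exceeded by the rungs of all points near `y`. -/
theorem exists_lt_rung (hP : IsSuccPair X K) (hc : IsLadderSystem c) (hy : y ∈ ladderPoints X K)
    (k : K) : ∃ b < y, ∀ z, b ≤ z → z < y → k < rung c z y := by
  obtain ⟨b, hb, hb'⟩ := hy.2 (c y '' Iic k)
    (by rintro _ ⟨i, -, rfl⟩; exact (hc y hy).1 i) (mk_image_le.trans_lt (hP.mk_Iic_lt k))
  refine ⟨b, hb, fun z hbz hz => ?_⟩
  by_contra! h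
  exact absurd (le_rung_term hc hy hz) ((hb' _ ⟨_, h, rfl⟩).trans_le hbz).not_ge

/-- The rung is constant on a left neighbourhood of a point of cofinality `#K`. -/
theorem exists_rung_eq (hP : IsSuccPair X K) (hc : IsLadderSystem c) (hy : y ∈ ladderPoints X K)
    (hx : x ∈ ladderPoints X K) (hxy : x < y) :
    ∃ b < x, ∀ z, b ≤ z → z < x → rung c z y = rung c x y := by
  obtain ⟨b, hb, hb'⟩ := hx.2 (c y '' Iio (rung c x y))
    (by rintro _ ⟨i, hi, rfl⟩; exact term_lt_of_lt_rung hi)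
    (mk_image_le.trans_lt (hP.mk_Iio_lt _))
  refine ⟨b, hb, fun z hbz hz => (rung_mono hc hy hz.le hxy).antisymm ?_⟩
  by_contra! h
  exact absurd (le_rung_term hc hy (hz.trans hxy)) ((hb' _ ⟨_, h, rfl⟩).trans_le hbz).not_ge

end Rung

namespace IsSuccPair

variable {X K : Type v} [LinearOrder X] [LinearOrder K]

theorem mk_entries_lt (hP : IsSuccPair X K) (S : Set (List X)) (hS : #S < #K) :
    #{z | ∃ ρ ∈ S, z ∈ ρ} < #K := by
  have : {z | ∃ ρ ∈ S, z ∈ ρ} = ⋃ ρ, ⋃ (_ : ρ ∈ S), {z | z ∈ ρ} := by ext; simp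
  rw [this, card_biUnion_lt_iff_forall_of_isRegular hP.regular hS]
  exact fun ρ _ => (lt_aleph0_iff_set_finite.2 ρ.finite_toSet).trans_le hP.aleph0_le

theorem mk_image2_lt {Y Z W : Type v} (hP : IsSuccPair X K) (f : Y → Z → W) {S : Set Y}
    {S' : Set Z} (hS : #S < #K) (hS' : #S' < #K) : #(image2 f S S') < #K := by
  rw [← image_prod]
  refine mk_image_le.trans_lt ?_
  rw [mk_setProd]
  simpa using mul_lt_of_lt hP.aleph0_le hS hS'

theorem mk_union_lt {Y : Type v} (hP : IsSuccPair X K) {S S' : Set Y} (hS : #S < #K)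
    (hS' : #S' < #K) : #(S ∪ S' : Set Y) < #K :=
  (Cardinal.mk_union_le _ _).trans_lt (add_lt_of_lt hP.aleph0_le hS hS')

end IsSuccPair

/-! ### Recovering the length of the first word. -/

section Decode

variable {X K : Type v} [LinearOrder X] [LinearOrder K] [WellFoundedLT K] [Nonempty K]

/-- Among all pairs of entries of `η` which are adjacent in the order of `X`, the pair `a < y` has
the largest rung, and `x` is the least entry below `y` with the same rung as `a`. -/
structure IsCut (c : X → K → X) (η : List X) (a x y : X) : Prop where
  mem_left : a ∈ η
  mem_right : y ∈ η
  lt : a < y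
  le_of_lt : ∀ z ∈ η, z < y → z ≤ a
  rung_le : ∀ a' ∈ η, ∀ y' ∈ η, a' < y' → (∀ z ∈ η, z < y' → z ≤ a') → rung c a' y' ≤ rung c a y
  mem : x ∈ η
  mem_lt : x < y
  rung_eq : rung c x y = rung c a y
  le_of_rung_eq : ∀ z ∈ η, z < y → rung c z y = rung c a y → x ≤ z

open Classical in
/-- The first position of the upper end of the cut of `η`, corrected by the coloring `col`. -/
noncomputable def cutDecode (c : X → K → X) (col : X → X → ℕ) (η : List X) : ℕ :=
  if h : ∃ p : X × X × X, IsCut c η p.1 p.2.1 p.2.2 then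
    η.idxOf h.choose.2.2 - col h.choose.2.1 h.choose.2.2 else 0

/-- `col` takes every value on pairs from any set outside the ideal of `T`, with prescribed
lower bounds for the rungs of the pair. -/
def IsGoodColoring (T : (X → X) → X → Prop) (c : X → K → X) (col : X → X → ℕ) : Prop :=
  ∀ A ⊆ ladderPoints X K, A ∉ avoidingSets K T → ∀ (n : ℕ) (ε : K) (s : X → X),
    ∃ x ∈ A, ∃ y ∈ A, x < y ∧ s x < y ∧ ε < rung c x y ∧
      (∀ z, x ≤ z → z ≤ s x → rung c z y = rung c x y) ∧ col x y = n

open Classical in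
-- Neighbours whose upper end is not `y` both lie below `ξ`, both lie in `U`, both lie in `V`, or
-- have upper end `x` and lower end below `ξ`; in each case the rung is below `ε`. Entries in `[x,
-- y)` come from `U` and share the rung of `x`, while entries below `x` lie below `ξ` and have
-- smaller rung at `y`.
theorem cutDecode_append {c : X → K → X} (hc : IsLadderSystem c) (col : X → X → ℕ)
    {U V : Set X} {x y ξ : X} {ε : K} (hx : x ∈ ladderPoints X K) (hy : y ∈ ladderPoints X K)
    (hξ : ξ < x) (hxy : x < y)
    (hU : ∀ z ∈ U, z < y) (hUlow : ∀ z ∈ U, z < x → z < ξ) (hVlow : ∀ z ∈ V, z < y → z < ξ)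
    (hUrung : ∀ z ∈ U, x ≤ z → rung c z y = rung c x y) (hε : ε < rung c x y)
    (hUU : ∀ z ∈ U, ∀ w ∈ U, rung c z w < ε) (hVV : ∀ z ∈ V, ∀ w ∈ V, rung c z w < ε)
    (hlow : ∀ z ∈ U ∪ V, ∀ w ∈ U ∪ V, z < ξ → w < ξ → rung c z w < ε)
    (hξx : rung c ξ x < ε) (hξy : rung c ξ y < ε)
    {ρ τ : List X} (hρ : ∀ z ∈ ρ, z ∈ U) (hτ : ∀ z ∈ τ, z ∈ V) (hxρ : x ∈ ρ) (hyτ : y ∈ τ)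
    (hcol : col x y = τ.idxOf y) : cutDecode c col (ρ ++ τ) = ρ.length := by
  have hxη : x ∈ ρ ++ τ := List.mem_append_left _ hxρ
  have hyη : y ∈ ρ ++ τ := List.mem_append_right _ hyτ
  have hmem : ∀ z ∈ ρ ++ τ, z ∈ U ∨ z ∈ V := fun z hz =>
    (List.mem_append.1 hz).imp (hρ z) (hτ z)
  have hmemU : ∀ z ∈ ρ ++ τ, x ≤ z → z < y → z ∈ U := fun z hz h1 h2 =>
    (hmem z hz).resolve_right fun h => ((hVlow z h h2).trans hξ).not_ge h1
  have hmemV : ∀ z ∈ ρ ++ τ, y ≤ z → z ∈ V := fun z hz h1 =>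
    (hmem z hz).resolve_left fun h => (hU z h).not_ge h1
  have hmemlow : ∀ z ∈ ρ ++ τ, z < x → z < ξ := fun z hz h1 =>
    (hmem z hz).elim (fun h => hUlow z h h1) fun h => hVlow z h (h1.trans hxy)
  have hsmall : ∀ a' ∈ ρ ++ τ, ∀ y' ∈ ρ ++ τ, a' < y' → (∀ z ∈ ρ ++ τ, z < y' → z ≤ a') →
      y' ≠ y → rung c a' y' < ε := by
    intro a' ha' y' hy' hlt hadj hne
    rcases lt_or_gt_of_ne hne with h | h
    · rcases lt_trichotomy y' x with h' | rfl | h'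
      · have h1 := hmemlow y' hy' h'
        exact hlow _ (hmem a' ha') _ (hmem y' hy') (hlt.trans h1) h1
      · exact (rung_mono hc hx (hmemlow a' ha' hlt).le hξ).trans_lt hξx
      · exact hUU _ (hmemU a' ha' (hadj x hxη h') (hlt.trans h)) _ (hmemU y' hy' h'.le h)
    · exact hVV _ (hmemV a' ha' (hadj y hyη h)) _ (hmemV y' hy' h.le)
  obtain ⟨a, ha, hamax⟩ := ((ρ ++ τ).toFinset.filter (· < y)).exists_max_image id
    ⟨x, by simp [hxρ, hxy]⟩
  simp only [Finset.mem_filter, List.mem_toFinset, id] at ha hamax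
  have hxa : x ≤ a := hamax x ⟨hxη, hxy⟩
  have hay : rung c a y = rung c x y := hUrung a (hmemU a ha.1 hxa ha.2) hxa
  have hlowrung : ∀ z ∈ ρ ++ τ, z < y → rung c z y = rung c x y → x ≤ z := by
    intro z hz hzy hzr
    by_contra! h
    exact ((rung_mono hc hy (hmemlow z hz h).le (hξ.trans hxy)).trans_lt (hξy.trans hε)).ne hzr
  have hcut : IsCut c (ρ ++ τ) a x y := by
    refine ⟨ha.1, hyη, ha.2, fun z hz h => hamax z ⟨hz, h⟩, ?_, hxη, hxy, hay.symm, ?_⟩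
    · intro a' ha' y' hy' hlt hadj
      by_cases h : y' = y
      · subst h
        exact rung_mono hc hy (hamax a' ⟨ha', hlt⟩) ha.2
      · exact hay ▸ ((hsmall a' ha' y' hy' hlt hadj h).trans hε).le
    · exact fun z hz hzy hzr => hlowrung z hz hzy (hzr.trans hay)
  have huniq : ∀ a' x' y', IsCut c (ρ ++ τ) a' x' y' → x' = x ∧ y' = y := by
    intro a' x' y' h
    have hy' : y' = y := by
      by_contra hne
      exact ((hsmall a' h.mem_left y' h.mem_right h.lt h.le_of_lt hne).trans hε).not_ge
        (hay ▸ h.rung_le a ha.1 y hyη ha.2 fun z hz hzy => hamax z ⟨hz, hzy⟩)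
    subst hy'
    have haa : a' = a :=
      (hamax a' ⟨h.mem_left, h.lt⟩).antisymm (h.le_of_lt a ha.1 ha.2)
    subst haa
    exact ⟨(h.le_of_rung_eq x hxη hxy hay.symm).antisymm
      (hlowrung x' h.mem h.mem_lt (h.rung_eq.trans hay)), rfl⟩
  have hex : ∃ p : X × X × X, IsCut c (ρ ++ τ) p.1 p.2.1 p.2.2 := ⟨(a, x, y), hcut⟩
  have hyρ : y ∉ ρ := fun h => (hU y (hρ y h)).false
  obtain ⟨h1, h2⟩ := huniq _ _ _ hex.choose_spec
  rw [cutDecode, dif_pos hex, h1, h2, hcol, List.idxOf_append_of_notMem hyρ, Nat.add_sub_cancel]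

theorem exists_decoding (hP : IsSuccPair X K) {T : (X → X) → X → Prop} (hT : IsLocalPred T)
    {c : X → K → X} (hc : IsLadderSystem c) {col : X → X → ℕ} (hcol : IsGoodColoring T c col)
    {A : Set X} (hA : A ∉ avoidingSets K T) (u v : A → Set (List X)) (σ : A → List X)
    (hu : ∀ x, #(u x) < #K) (hv : ∀ x, #(v x) < #K) (hmem : ∀ x : A, ∀ ρ ∈ u x, (x : X) ∈ ρ)
    (hpre : ∀ x : A, ∀ τ ∈ v x, σ x ++ [(x : X)] <+: τ) :
    ∃ x y : A, x < y ∧ ∀ ρ ∈ u x, ∀ τ ∈ v y, cutDecode c col (ρ ++ τ) = ρ.length := by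
  classical
  let U : X → Set X := fun x => {z | ∃ ρ ∈ {ρ | ∃ h : x ∈ A, ρ ∈ u ⟨x, h⟩}, z ∈ ρ}
  let V : X → Set X := fun x => {z | ∃ ρ ∈ {ρ | ∃ h : x ∈ A, ρ ∈ v ⟨x, h⟩}, z ∈ ρ}
  -- The point `x` may already occur in `σ x`, so this is its first occurrence rather than the
  -- length of `σ x`.
  let n : X → ℕ := fun x => if h : x ∈ A then (σ ⟨x, h⟩ ++ [x]).idxOf x else 0
  have hU : ∀ x, #(U x) < #K := fun x => hP.mk_entries_lt _ (by
    by_cases h : x ∈ A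
    · simpa [h] using hu ⟨x, h⟩
    · simpa [h] using aleph0_pos.trans_le hP.aleph0_le)
  have hV : ∀ x, #(V x) < #K := fun x => hP.mk_entries_lt _ (by
    by_cases h : x ∈ A
    · simpa [h] using hv ⟨x, h⟩
    · simpa [h] using aleph0_pos.trans_le hP.aleph0_le)
  have hl : ∀ x, ∃ b, x ∈ ladderPoints X K → b < x ∧ ∀ z ∈ U x ∪ V x, z < x → z < b := by
    intro x
    by_cases hx : x ∈ ladderPoints X K
    · obtain ⟨b, hb, hb'⟩ := hx.2 ((U x ∪ V x) ∩ Iio x) inter_subset_right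
        ((mk_le_mk_of_subset inter_subset_left).trans_lt (hP.mk_union_lt (hU x) (hV x)))
      exact ⟨b, fun _ => ⟨hb, fun z hz hzx => hb' z ⟨hz, hzx⟩⟩⟩
    · exact ⟨x, fun h => absurd h hx⟩
  choose l hl using hl
  obtain ⟨ξ, hA₁⟩ := exists_fiber_notMem_of_lt hP hT (inter_ladderPoints_notMem hA) l
    fun x hx => (hl x hx.2).1
  -- Entries below `ξ` coming from different indices also become neighbours. Bounding their codes in
  -- `K` by a common `ε₁` confines them to one set `B` of size less than `#K`, on which the rungs
  -- are bounded.
  obtain ⟨e⟩ := (le_def (Iic ξ) K).1 (hP.mk_Iic_le ξ)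
  let e' : X → K := fun z => if h : z ≤ ξ then e ⟨z, h⟩ else Classical.arbitrary K
  have hf : ∀ x, ∃ ε : K, (∀ z ∈ U x ∪ V x, e' z < ε) ∧ (∀ z ∈ U x, ∀ w ∈ U x, rung c z w < ε) ∧
      (∀ z ∈ V x, ∀ w ∈ V x, rung c z w < ε) ∧ rung c ξ x < ε := by
    intro x
    obtain ⟨ε, hε⟩ := hP.exists_gt_index
      ((e' '' (U x ∪ V x) ∪ image2 (rung c) (U x) (U x)) ∪
        (image2 (rung c) (V x) (V x) ∪ {rung c ξ x}))
      (hP.mk_union_lt (hP.mk_union_lt (mk_image_le.trans_lt (hP.mk_union_lt (hU x) (hV x)))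
        (hP.mk_image2_lt _ (hU x) (hU x))) (hP.mk_union_lt (hP.mk_image2_lt _ (hV x) (hV x))
        (by simpa using one_lt_aleph0.trans_le hP.aleph0_le)))
    exact ⟨ε, fun z hz => hε _ (.inl (.inl (mem_image_of_mem _ hz))),
      fun z hz w hw => hε _ (.inl (.inr (mem_image2_of_mem hz hw))),
      fun z hz w hw => hε _ (.inr (.inl (mem_image2_of_mem hz hw))), hε _ (.inr (.inr rfl))⟩
  choose f hf using hf
  obtain ⟨ε₁, hA₂⟩ := exists_fiber_notMem hP hT hA₁ le_rfl f
  obtain ⟨⟨m⟩, hA₃⟩ := exists_fiber_notMem hP hT hA₂ (ι := ULift ℕ)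
    (by simpa using hP.aleph0_le) fun x => ⟨n x⟩
  let B : Set X := {z | z ≤ ξ ∧ e' z < ε₁}
  have hB : #B < #K := by
    refine lt_of_le_of_lt ?_ (hP.mk_Iio_lt ε₁)
    refine mk_le_of_injective (f := fun z : B => (⟨e' z, z.2.2⟩ : Iio ε₁)) fun z w h => ?_
    have h' : e' z = e' w := congrArg Subtype.val h
    simp only [e', dif_pos z.2.1, dif_pos w.2.1] at h'
    exact Subtype.ext (congrArg (fun t : Iic ξ => (t : X)) (e.injective h'))
  obtain ⟨ε, hε⟩ := hP.exists_gt_index (image2 (rung c) B B ∪ {ε₁})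
    (hP.mk_union_lt (hP.mk_image2_lt _ hB hB)
      (by simpa using one_lt_aleph0.trans_le hP.aleph0_le))
  have hε₁ : ε₁ < ε := hε _ (.inr rfl)
  choose s hs using fun x => hP.exists_gt (U x) (hU x).le
  obtain ⟨x, ⟨⟨⟨⟨hxA, hxE⟩, hlx⟩, hfx⟩, hnx⟩, y, ⟨⟨⟨⟨hyA, hyE⟩, hly⟩, hfy⟩, hny⟩, hxy, hsy, hεr,
    hr, hcxy⟩ := hcol _ (fun x hx => hx.1.1.1.2) hA₃ m ε s
  refine ⟨⟨x, hxA⟩, ⟨y, hyA⟩, hxy, fun ρ hρ τ hτ => ?_⟩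
  have hlx' := hl x hxE
  have hly' := hl y hyE
  rw [hlx] at hlx'
  rw [hly] at hly'
  have hfx' := hf x
  have hfy' := hf y
  rw [hfx] at hfx'
  rw [hfy] at hfy'
  refine cutDecode_append hc col (U := U x) (V := V y) (ξ := ξ) (ε := ε) hxE hyE hlx'.1 hxy
    (fun z hz => (hs x z hz).trans hsy) (fun z hz => hlx'.2 z (.inl hz))
    (fun z hz => hly'.2 z (.inr hz)) (fun z hz hxz => hr z hxz (hs x z hz).le) hεr
    (fun z hz w hw => (hfx'.2.1 z hz w hw).trans hε₁)
    (fun z hz w hw => (hfy'.2.2.1 z hz w hw).trans hε₁) ?_ (hfx'.2.2.2.trans hε₁)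
    (hfy'.2.2.2.trans hε₁) (fun z hz => ⟨ρ, ⟨hxA, hρ⟩, hz⟩) (fun z hz => ⟨τ, ⟨hyA, hτ⟩, hz⟩)
    (hmem _ ρ hρ) ((hpre _ τ hτ).subset (by simp)) ?_
  · have hBmem : ∀ z ∈ U x ∪ V y, z < ξ → z ∈ B := fun z hz hzξ => ⟨hzξ.le, hz.elim
      (fun h => hfx'.1 z (.inl h)) fun h => hfy'.1 z (.inr h)⟩
    exact fun z hz w hw hzξ hwξ => hε _ (.inl (mem_image2_of_mem (hBmem z hz hzξ) (hBmem w hw hwξ)))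
  · rw [hcxy, ← (hpre _ τ hτ).idxOf_eq_of_mem (by simp)]
    have : n y = m := congrArg ULift.down hny
    rw [← this]
    simp only [n, dif_pos hyA]

end Decode

/-! ### First differences of binary sequences. -/

section FirstDiff

variable {I J : Type v} [LinearOrder J] [WellFoundedLT J] [Nonempty J]

open Classical in
/-- The least coordinate at which the sequences of `x` and `y` differ. -/
noncomputable def firstDiff (r : I → J → Bool) (x y : I) : J :=
  if h : {k | r x k ≠ r y k}.Nonempty then wellFounded_lt.min _ h else Classical.arbitrary J

variable {r : I → J → Bool} {x y z : I} {k : J}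

theorem firstDiff_ne (hr : Function.Injective r) (h : x ≠ y) :
    r x (firstDiff r x y) ≠ r y (firstDiff r x y) := by
  have h' : {k | r x k ≠ r y k}.Nonempty := by
    by_contra! h''
    exact h (hr (funext fun k => by_contra fun hk => (h'' ▸ hk : k ∈ (∅ : Set J))))
  rw [firstDiff, dif_pos h']
  exact wellFounded_lt.min_mem _ h'

theorem firstDiff_le (h : r x k ≠ r y k) : firstDiff r x y ≤ k := by
  have h' : {k | r x k ≠ r y k}.Nonempty := ⟨k, h⟩
  rw [firstDiff, dif_pos h']
  exact not_lt.1 (wellFounded_lt.not_lt_min {k | r x k ≠ r y k} h)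

theorem eq_of_lt_firstDiff (h : k < firstDiff r x y) : r x k = r y k := by
  by_contra h'
  exact (firstDiff_le h').not_gt h

theorem firstDiff_eq (hr : Function.Injective r) (h : x ≠ y)
    (hz : ∀ k ≤ firstDiff r x y, r z k = r x k) : firstDiff r z y = firstDiff r x y := by
  have h1 : r z (firstDiff r x y) ≠ r y (firstDiff r x y) := hz _ le_rfl ▸ firstDiff_ne hr h
  have h2 : z ≠ y := fun h => h1 (by rw [h])
  refine (firstDiff_le h1).antisymm ?_
  by_contra! h3
  exact firstDiff_ne hr h2 ((hz _ h3.le).trans (eq_of_lt_firstDiff h3))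

end FirstDiff

/-! ### The case `2^κ ≤ ν` for all `κ < ν`. -/

section StrongLimit

variable {X K : Type v} [LinearOrder X] [LinearOrder K]

theorem exists_injOn_Iio (hP : IsSuccPair X K) : ∃ e : X → X → K, ∀ x, InjOn (e x) (Iio x) := by
  classical
  have hne := hP.nonempty_index
  let e : ∀ x, Iio x ↪ K := fun x => Classical.choice ((le_def (Iio x) K).1 (hP.mk_Iio_le x))
  refine ⟨fun x y => if h : y < x then e x ⟨y, h⟩ else Classical.arbitrary K, fun x y hy z hz h => ?_⟩
  simp only [mem_Iio] at hy hz
  simp only [dif_pos hy, dif_pos hz] at h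
  exact congrArg (fun t : Iio x => (t : X)) ((e x).injective h)

theorem isLocalPred_true : IsLocalPred (X := X) fun _ _ => True := fun _ _ _ _ _ _ _ => trivial

/-- The points of cofinality `#K` split into countably many stationary sets. -/
theorem exists_stationary_partition [WellFoundedLT X] [WellFoundedLT K] (hP : IsSuccPair X K) :
    ∃ π : X → ℕ, ∀ n, {x ∈ ladderPoints X K | π x = n} ∉ avoidingSets K fun _ _ => True := by
  classical
  obtain ⟨e, he⟩ := exists_injOn_Iio hP
  have h1 : ∀ y : X, {x ∈ ladderPoints X K | y < x} ∉ avoidingSets K fun _ _ => True := by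
    rintro y ⟨g, hg⟩
    obtain ⟨x, ⟨hxE, hxc⟩, hyx⟩ := hP.exists_mem_closedPts g y
    exact hg x ⟨hxE, hyx⟩ hxE hxc trivial
  -- As in an Ulam matrix: for each `y`, the value `e x y` is constant on a stationary set of `x`.
  -- Some constant serves infinitely many `y`, and injectivity of `e x` makes the corresponding sets
  -- disjoint.
  choose k hk using fun y => exists_fiber_notMem hP isLocalPred_true (h1 y) le_rfl fun x => e x y
  have : Infinite X := infinite_iff.2 (hP.aleph0_le.trans hP.mk_lt.le)
  obtain ⟨k₀, hk₀⟩ := Cardinal.exists_infinite_fiber k hP.mk_lt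
  let y : ℕ ↪ k ⁻¹' {k₀} := Infinite.natEmbedding _
  refine ⟨fun x => if h : ∃ n, (y n : X) < x ∧ e x (y n) = k₀ then h.choose else 0, fun n hn => ?_⟩
  refine hk (y n) (avoidingSets_mono ?_ hn)
  rintro x ⟨⟨hxE, hyx⟩, hex⟩
  refine ⟨hxE, ?_⟩
  have h : ∃ n, (y n : X) < x ∧ e x (y n) = k₀ := ⟨n, hyx, hex.trans (y n).2⟩
  refine (dif_pos h).trans ?_
  exact y.injective (Subtype.ext (he x h.choose_spec.1 hyx
    (h.choose_spec.2.trans (hex.trans (y n).2).symm)))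

variable [WellFoundedLT X] [WellFoundedLT K] [Nonempty K]

open Classical in
/-- The color under `π` of the least point above `x` which is `y` or is enumerated in `Iio y` not
later than the place where the sequences of `x` and `y` differ. -/
noncomputable def firstDiffColor (e : X → X → K) (r : X → K → Bool) (π : X → ℕ) (x y : X) : ℕ :=
  if h : {w | x < w ∧ (w = y ∨ w < y ∧ e y w ≤ firstDiff r x y)}.Nonempty then
    π (wellFounded_lt.min _ h) else 0

theorem firstDiffColor_eq {e : X → X → K} {r : X → K → Bool} {π : X → ℕ} {x y w : X}
    (hxw : x < w) (hwy : w < y) (he : e y w ≤ firstDiff r x y)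
    (hmin : ∀ w', x < w' → w' < w → firstDiff r x y < e y w') :
    firstDiffColor e r π x y = π w := by
  have h : {w | x < w ∧ (w = y ∨ w < y ∧ e y w ≤ firstDiff r x y)}.Nonempty :=
    ⟨w, hxw, .inr ⟨hwy, he⟩⟩
  rw [firstDiffColor, dif_pos h]
  congr 1
  refine le_antisymm (not_lt.1 (wellFounded_lt.not_lt_min
    {w | x < w ∧ (w = y ∨ w < y ∧ e y w ≤ firstDiff r x y)} ⟨hxw, .inr ⟨hwy, he⟩⟩)) ?_
  obtain ⟨h1, h2⟩ := wellFounded_lt.min_mem _ h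
  by_contra! h3
  rcases h2 with h2 | h2
  · exact (h3.trans hwy).ne h2
  · exact (hmin _ h1 h3).not_ge h2.2

theorem isGoodColoring_firstDiffColor (hP : IsSuccPair X K)
    (hpow : ∀ k : K, #(Iic k → Bool) ≤ #K) {c : X → K → X} (hc : IsLadderSystem c)
    {e : X → X → K} (he : ∀ x, InjOn (e x) (Iio x)) {r : X → K → Bool}
    (hr : Function.Injective r) {π : X → ℕ}
    (hπ : ∀ n, {x ∈ ladderPoints X K | π x = n} ∉ avoidingSets K fun _ _ => True) :
    IsGoodColoring (fun _ _ => True) c (firstDiffColor e r π) := by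
  classical
  intro A _ hA n ε s
  let N : Type v := Σ k : K, (Iic k → Bool)
  let nd : X → K → N := fun x k => ⟨k, fun j => r x j⟩
  have hnd : ∀ {x y k}, nd x k = nd y k → ∀ j ≤ k, r x j = r y j := by
    intro x y k h j hj
    have := eq_of_heq (Sigma.mk.inj h).2
    exact congrFun this ⟨j, hj⟩
  have hN : #N ≤ #K := by
    rw [mk_sigma]
    exact (sum_le_sum _ _ hpow).trans (by simpa using (mul_eq_self hP.aleph0_le).le)
  let F : N → Set X := fun t => {a ∈ A | nd a t.1 = t}
  -- There are at most `#K` nodes, so one `b₀` exceeds all members of bounded fibers; every initial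
  -- segment of an `a ∈ A` above `b₀` is then shared by unboundedly many members of `A`.
  obtain ⟨b₀, hb₀⟩ : ∃ b₀, ∀ t, (∀ b, ∃ a ∈ F t, b < a) ∨ ∀ a ∈ F t, a < b₀ := by
    have : ∀ t, ∃ b, (∀ b, ∃ a ∈ F t, b < a) ∨ ∀ a ∈ F t, a ≤ b := fun t => by
      by_cases h : ∀ b, ∃ a ∈ F t, b < a
      · exact ⟨(hP.exists_gt ∅ (by simp)).choose, .inl h⟩
      · push Not at h
        exact h.imp fun b hb => .inr hb
    choose b hb using this
    obtain ⟨b₀, hb₀⟩ := hP.exists_gt (range b) (mk_range_le.trans hN)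
    exact ⟨b₀, fun t => (hb t).imp id fun h a ha => (h a ha).trans_lt (hb₀ _ ⟨t, rfl⟩)⟩
  have hbig : ∀ a ∈ A, b₀ < a → ∀ k b, ∃ a' ∈ A, nd a' k = nd a k ∧ b < a' := fun a ha hab k b => by
    obtain ⟨a', ha', hb⟩ := ((hb₀ (nd a k)).resolve_right fun h => (h a ⟨ha, rfl⟩).not_gt hab) b
    exact ⟨a', ha'.1, ha'.2, hb⟩
  have hg₁ : ∀ x : X, ∃ b, ∀ t, (∀ b, ∃ a ∈ F t, b < a) → ∃ a ∈ F t, x < a ∧ a < b ∧ s a < b := by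
    intro x
    have : ∀ t, ∃ a, (∀ b, ∃ a ∈ F t, b < a) → a ∈ F t ∧ x < a := fun t => by
      by_cases h : ∀ b, ∃ a ∈ F t, b < a
      · exact (h x).imp fun a ha _ => ha
      · exact ⟨x, fun h' => absurd h' h⟩
    choose a ha using this
    obtain ⟨b, hb⟩ := hP.exists_gt (range fun p : N × Fin 2 => ![a p.1, s (a p.1)] p.2) (by
      refine mk_range_le.trans ?_
      rw [mk_prod]
      simpa using mul_le_of_le hP.aleph0_le hN ((natCast_lt_aleph0 (n := 2)).le.trans hP.aleph0_le))
    exact ⟨b, fun t ht => ⟨a t, (ha t ht).1, (ha t ht).2, hb _ ⟨(t, 0), rfl⟩, hb _ ⟨(t, 1), rfl⟩⟩⟩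
  choose g₁ hg₁ using hg₁
  have hg₂ : ∀ b : X, ∃ x ∈ ladderPoints X K, π x = n ∧ x ∈ closedPts g₁ ∧ b < x := by
    intro b
    by_contra! h
    refine hπ n ⟨fun z => max (g₁ z) b, fun x hx hxE hxc => ?_⟩
    obtain ⟨i, hi⟩ := ladderPoints.exists_lt hP hxE
    exact absurd ((le_max_right _ _).trans_lt (hxc i hi))
      (h x hxE hx.2 (closedPts_anti (fun z => le_max_left _ _) hxc)).not_gt
  choose g₂ hg₂ using hg₂
  obtain ⟨y, hyA, hyE, hyc, hby⟩ : ∃ y ∈ A, y ∈ ladderPoints X K ∧ y ∈ closedPts g₂ ∧ b₀ < y := by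
    by_contra! h
    refine hA ⟨fun z => max (g₂ z) b₀, fun y hy hyE hyc => ?_⟩
    obtain ⟨i, hi⟩ := ladderPoints.exists_lt hP hyE
    exact absurd ((le_max_right _ _).trans_lt (hyc i hi))
      (h y hy hyE (closedPts_anti (fun z => le_max_left _ _) hyc)).not_gt
  obtain ⟨b₁, hb₁, hb₁'⟩ := exists_lt_rung hP hc hyE ε
  obtain ⟨hwE, hπw, hwc, hbw⟩ := hg₂ b₁
  have hwy : g₂ b₁ < y := hyc b₁ hb₁
  generalize g₂ b₁ = w at hwE hπw hwc hbw hwy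
  obtain ⟨y', hy'A, hy'n, hy'⟩ := hbig y hyA hby (e y w) y
  have hyy' : y' ≠ y := hy'.ne'
  have hm : e y w < firstDiff r y' y := by
    by_contra! h
    exact firstDiff_ne hr hyy' (hnd hy'n _ h)
  -- Fewer than `#K` candidates lie below `w`, so they are bounded below it. Any `x` in between sees
  -- `w` first, provided its first difference with `y` is that of `y'`.
  obtain ⟨b₂, hb₂, hb₂'⟩ := hwE.2 {z | z < w ∧ e y z ≤ firstDiff r y' y} (fun z hz => hz.1) (by
    refine lt_of_le_of_lt ?_ (hP.mk_Iic_lt (firstDiff r y' y))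
    rw [← mk_image_eq_of_injOn (e y) _ ((he y).mono fun z hz => hz.1.trans hwy)]
    exact mk_le_mk_of_subset (by rintro _ ⟨z, hz, rfl⟩; exact hz.2))
  obtain ⟨b₃, hb₃, hb₃'⟩ := exists_rung_eq hP hc hyE hwE hwy
  obtain ⟨x, hxF, hbx, hxg, hsg⟩ := hg₁ (max b₂ b₃) (nd y' (firstDiff r y' y)) fun b => by
    obtain ⟨a, ha, h1, h2⟩ := hbig y' hy'A (hby.trans hy') (firstDiff r y' y) b
    exact ⟨a, ⟨ha, h1⟩, h2⟩
  have hgw := hwc _ (max_lt hb₂ hb₃)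
  have hxw : x < w := hxg.trans hgw
  have hsw : s x < w := hsg.trans hgw
  have hb₃x : b₃ ≤ x := (le_max_right _ _).trans hbx.le
  have hxr := hb₃' x hb₃x hxw
  have hΔ : firstDiff r x y = firstDiff r y' y := firstDiff_eq hr hyy' (hnd hxF.2)
  refine ⟨x, hxF.1, y, hyA, hxw.trans hwy, hsw.trans hwy, ?_, fun z hxz hzs => ?_, ?_⟩
  · rw [hxr]
    exact hb₁' w hbw.le hwy
  · rw [hxr]
    exact hb₃' z (hb₃x.trans hxz) (hzs.trans_lt hsw)
  · rw [firstDiffColor_eq hxw hwy (hΔ ▸ hm.le), hπw]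
    intro w' hxw' hw'
    rw [hΔ]
    by_contra! h
    exact (hb₂' w' ⟨hw', h⟩).not_ge ((le_max_left _ _).trans (hbx.le.trans hxw'.le))

end StrongLimit

/-! ### The case `2^κ > ν` for some `κ < ν`. -/

section NotStrongLimit

variable {X K Q : Type v} [LinearOrder X] [LinearOrder K] [LinearOrder Q]
  [WellFoundedLT X] [WellFoundedLT K] [WellFoundedLT Q] [Nonempty K] [Nonempty Q]

omit [WellFoundedLT X] [WellFoundedLT K] [Nonempty K] in
/-- If the tree of initial segments of the sequences `r i` has fewer than `#K` nodes, then any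
unbounded set of indices splits off unboundedly many of its members from some `r z` at infinitely
many levels. -/
theorem exists_infinite_firstDiff (hP : IsSuccPair X K) (hQK : #Q < #K)
    (hQ : ∀ q : Q, #(Iic q → Bool) < #K) {r : K → Q → Bool} (hr : Function.Injective r)
    {I : Set K} (hI : ∀ k, ∃ i ∈ I, k < i) :
    ∃ z, {q | ∀ k, ∃ i ∈ I, k < i ∧ firstDiff r i z = q}.Infinite := by
  classical
  by_contra! hfin
  let N : Type v := Σ q : Q, (Iic q → Bool)
  let nd : K → Q → N := fun i q => ⟨q, fun j => r i j⟩
  have hnd : ∀ {i j q}, nd i q = nd j q → ∀ p ≤ q, r i p = r j p := by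
    intro i j q h p hp
    exact congrFun (eq_of_heq (Sigma.mk.inj h).2) ⟨p, hp⟩
  have hN : #N < #K := by
    rw [mk_sigma]
    exact sum_lt_of_isRegular hP.regular hQK hQ
  obtain ⟨k₀, hk₀⟩ : ∃ k₀, ∀ t : N, (∀ k, ∃ i ∈ I, nd i t.1 = t ∧ k < i) ∨
      ∀ i ∈ I, nd i t.1 = t → i < k₀ := by
    have : ∀ t : N, ∃ k, (∀ k, ∃ i ∈ I, nd i t.1 = t ∧ k < i) ∨
        ∀ i ∈ I, nd i t.1 = t → i ≤ k := fun t => by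
      by_cases h : ∀ k, ∃ i ∈ I, nd i t.1 = t ∧ k < i
      · exact ⟨hP.nonempty_index.some, .inl h⟩
      · push Not at h
        exact h.imp fun k hk => .inr hk
    choose k hk using this
    obtain ⟨k₀, hk₀⟩ := hP.exists_gt_index (range k) (mk_range_le.trans_lt hN)
    exact ⟨k₀, fun t => (hk t).imp id fun h i hi hit => (h i hi hit).trans_lt (hk₀ _ ⟨t, rfl⟩)⟩
  have hmax : ∀ z, ∃ m : Option Q, ∀ q, (∀ k, ∃ i ∈ I, k < i ∧ firstDiff r i z = q) →
      ∃ p ∈ m, q ≤ p := by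
    intro z
    rcases (hfin z).toFinset.eq_empty_or_nonempty with h | h
    · refine ⟨none, fun q hq => ?_⟩
      have : q ∈ (hfin z).toFinset := by simpa using hq
      simp [h] at this
    · exact ⟨some ((hfin z).toFinset.max' h), fun q hq => ⟨_, rfl,
        Finset.le_max' _ _ (by simpa using hq)⟩⟩
  choose m hm using hmax
  -- If `z'` shares with `z` the node at the last frequent level of `z`, they split above it; but
  -- unboundedly many `i` follow `z'` through that split, so it is itself a frequent level of `z`.
  have hinj : InjOn (fun z => (m z).map (nd z)) (I ∩ Ioi k₀) := by
    rintro z ⟨hz, -⟩ z' ⟨hz', hz'k⟩ h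
    by_contra hne
    obtain ⟨p, hp, hqp⟩ := hm z (firstDiff r z' z) fun k => by
      obtain ⟨i, hi, hit, hki⟩ := ((hk₀ (nd z' (firstDiff r z' z))).resolve_right
        fun h => (h z' hz' rfl).not_gt hz'k) k
      exact ⟨i, hi, hki, firstDiff_eq hr (Ne.symm hne) (hnd hit)⟩
    have h1 : (m z).map (nd z) = some (nd z p) := by rw [Option.mem_def.1 hp]; rfl
    obtain ⟨p', -, hp''⟩ := Option.map_eq_some_iff.1 (h.symm.trans h1)
    have hpp : p' = p := congrArg Sigma.fst hp''
    subst hpp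
    exact firstDiff_ne hr (Ne.symm hne) (hnd hp'' _ hqp)
  have hcard : #(I ∩ Ioi k₀ : Set K) < #K := by
    rw [← mk_image_eq_of_injOn _ _ hinj]
    refine (mk_set_le _).trans_lt ?_
    rw [mk_option]
    exact add_lt_of_lt hP.aleph0_le hN (one_lt_aleph0.trans_le hP.aleph0_le)
  obtain ⟨b, hb⟩ := hP.exists_gt_index _ hcard
  obtain ⟨i, hi, hbi⟩ := hI (max b k₀)
  exact (hb i ⟨hi, (le_max_right _ _).trans_lt hbi⟩).not_gt ((le_max_left _ _).trans_lt hbi)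

/-- The levels at which the rungs of the closed points of `g` split off from `z` cofinally
often below `y`. -/
def splitLevels (c : X → K → X) (r : K → Q → Bool) (z : K) (y : X) (g : X → X) : Set Q :=
  {q | ∀ b < y, ∃ x ∈ ladderPoints X K, x ∈ closedPts g ∧ b < x ∧ x < y ∧
    firstDiff r (rung c x y) z = q}

variable {c : X → K → X} {r : K → Q → Bool}

omit [WellFoundedLT X] in
theorem splitLevels_anti {z : K} {y : X} {g g' : X → X} (h : ∀ x, g x ≤ g' x) :
    splitLevels c r z y g' ⊆ splitLevels c r z y g := fun _ hq b hb => by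
  obtain ⟨x, hxE, hxc, hx⟩ := hq b hb
  exact ⟨x, hxE, closedPts_anti h hxc, hx⟩

/-- A single `z` works for all `g`: otherwise a common bound of the `#K` counterexamples `g z`
refutes the previous tree lemma, applied to the rungs below a limit of closed points. -/
theorem exists_splitLevels_infinite (hP : IsSuccPair X K) (hQK : #Q < #K)
    (hQ : ∀ q : Q, #(Iic q → Bool) < #K) (hr : Function.Injective r) (hc : IsLadderSystem c) :
    ∃ z, ∀ g, ∃ y ∈ ladderPoints X K, y ∈ closedPts g ∧ (splitLevels c r z y g).Infinite := by
  by_contra! h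
  choose g hg using h
  obtain ⟨g₁, hg₁⟩ := hP.exists_ge_family le_rfl g
  choose g₂ hg₂ hg₂' using hP.exists_mem_closedPts g₁
  obtain ⟨i₀⟩ := hP.nonempty_index
  obtain ⟨x₀, -⟩ := hP.exists_gt ∅ (by simp)
  obtain ⟨y, ⟨hyE, hyc⟩, -⟩ := hP.exists_mem_closedPts (fun x => max (g₁ x) (g₂ x)) x₀
  have hyc₁ : y ∈ closedPts g₁ := closedPts_anti (fun _ => le_max_left _ _) hyc
  have hyc₂ : y ∈ closedPts g₂ := closedPts_anti (fun _ => le_max_right _ _) hyc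
  obtain ⟨z, hz⟩ := exists_infinite_firstDiff hP hQK hQ hr
    (I := {i | ∃ x ∈ ladderPoints X K ∩ closedPts g₁, x < y ∧ rung c x y = i}) fun k => by
      obtain ⟨b, hb, hb'⟩ := exists_lt_rung hP hc hyE k
      exact ⟨_, ⟨g₂ b, hg₂ b, hyc₂ b hb, rfl⟩, hb' _ (hg₂' b).le (hyc₂ b hb)⟩
  refine hz (Set.Finite.subset (hg z y hyE (closedPts_anti (hg₁ z) hyc₁)) fun q hq b hb => ?_)
  obtain ⟨i, ⟨x, ⟨hxE, hxc⟩, hxy, rfl⟩, hbx, hxq⟩ := hq (rung c b y)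
  refine ⟨x, hxE, closedPts_anti (hg₁ z) hxc, ?_, hxy, hxq⟩
  by_contra! h
  exact (rung_mono hc hyE h hb).not_gt hbx

omit [WellFoundedLT X] in
-- If every `h` failed, then coloring the infinite sets of split levels of `g` onto `ℕ` would yield
-- a larger function which loses a level at each of its closed points with infinitely many levels.
-- Iterating along `K` loses `#K` distinct levels at a single `y`, too many for `Q`.
theorem exists_coloring_splitLevels (hP : IsSuccPair X K) (hQK : #Q < #K) {z : K}
    (hz : ∀ g, ∃ y ∈ ladderPoints X K, y ∈ closedPts g ∧ (splitLevels c r z y g).Infinite) :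
    ∃ h : X → Q → ℕ, ∀ g, ∃ y ∈ ladderPoints X K, y ∈ closedPts g ∧
      ∀ n, ∃ q ∈ splitLevels c r z y g, h y q = n := by
  classical
  by_contra! H
  have hstep : ∀ g : X → X, ∃ g' : X → X, (∀ x, g x ≤ g' x) ∧ ∀ y ∈ ladderPoints X K,
      y ∈ closedPts g' → (splitLevels c r z y g).Infinite →
        ∃ q ∈ splitLevels c r z y g, q ∉ splitLevels c r z y g' := by
    intro g
    have hsurj : ∀ y, ∃ f : Q → ℕ, (splitLevels c r z y g).Infinite →
        ∀ n, ∃ q ∈ splitLevels c r z y g, f q = n := by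
      intro y
      by_cases hy : (splitLevels c r z y g).Infinite
      · have := hy.to_subtype
        let e := Infinite.natEmbedding (splitLevels c r z y g)
        refine ⟨fun q => if hq : q ∈ splitLevels c r z y g then Function.invFun e ⟨q, hq⟩ else 0,
          fun _ n => ⟨e n, (e n).2, ?_⟩⟩
        refine (dif_pos (e n).2).trans ?_
        exact Function.leftInverse_invFun e.injective n
      · exact ⟨fun _ => 0, fun h => absurd h hy⟩
    choose f hf using hsurj
    obtain ⟨g₀, hg₀⟩ := H f
    refine ⟨fun x => max (g x) (g₀ x), fun x => le_max_left _ _, fun y hyE hyc hyI => ?_⟩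
    obtain ⟨n, hn⟩ := hg₀ y hyE (closedPts_anti (fun x => le_max_right _ _) hyc)
    obtain ⟨q, hq, hqn⟩ := hf y hyI n
    exact ⟨q, hq, fun h => hn q (splitLevels_anti (fun x => le_max_right _ _) h) hqn⟩
  choose st hst hst' using hstep
  obtain ⟨b, hb⟩ := IsSuccPair.exists_seq (K := K) (Y := X → X)
    (fun S g => ∀ f ∈ S, ∀ x, st f x ≤ g x)
    (fun S hS => by
      obtain ⟨g, hg⟩ := hP.exists_ge_family hS fun f : S => st f
      exact ⟨g, fun f hf => hg ⟨f, hf⟩⟩) fun k => (hP.mk_Iio_lt k).le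
  obtain ⟨g, hg⟩ := hP.exists_ge_family le_rfl fun i => st (b i)
  obtain ⟨y, hyE, hyc, hyI⟩ := hz g
  choose q hq hq' using fun i => hst' (b i) y hyE (closedPts_anti (hg i) hyc)
    (hyI.mono (splitLevels_anti fun x => (hst _ x).trans (hg i x)))
  have hlt : ∀ i j, i < j → q i ≠ q j := fun i j hij h =>
    hq' i (h ▸ splitLevels_anti (hb j _ ⟨i, hij, rfl⟩) (hq j))
  have hinj : Function.Injective q := fun i j h => by
    by_contra hne
    rcases lt_or_gt_of_ne hne with h' | h'
    · exact hlt i j h' h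
    · exact hlt j i h' h.symm
  exact (mk_le_of_injective hinj).not_gt hQK

/-- Below `y`, every color appears cofinally often on the closed points of `g`. -/
def HitsAllColors (K : Type v) (col : X → X → ℕ) (g : X → X) (y : X) : Prop :=
  ∀ n, ∀ b < y, ∃ x ∈ ladderPoints X K, x ∈ closedPts g ∧ b < x ∧ x < y ∧ col x y = n

omit [LinearOrder K] [WellFoundedLT X] [WellFoundedLT K] [Nonempty K] in
theorem isLocalPred_hitsAllColors (col : X → X → ℕ) : IsLocalPred (HitsAllColors K col) := by
  intro g g' i y hi hgg hy n b hb
  obtain ⟨x, hxE, hxc, hbx, hx⟩ := hy n (max b i) (max_lt hb hi)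
  exact ⟨x, hxE, hgg x ((le_max_right _ _).trans_lt hbx) hxc, (le_max_left _ _).trans_lt hbx, hx⟩

omit [WellFoundedLT X] in
-- Given `y`, the color depends only on the rung, which is constant just below a correctly colored
-- `w`. Closure of `w` under `g` puts there a member `x` of `A` together with `s x`.
theorem isGoodColoring_of_hitsAllColors (hP : IsSuccPair X K) (hc : IsLadderSystem c)
    (h : X → K → ℕ) : IsGoodColoring (HitsAllColors K fun x y => h y (rung c x y)) c
      fun x y => h y (rung c x y) := by
  intro A hAE hA n ε s
  have hg : ∀ x : X, ∃ b, ∃ a ∈ A, x < a ∧ a < b ∧ s a < b := fun x => by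
    obtain ⟨a, ha, hxa⟩ := exists_gt_of_notMem_avoidingSets hP hA x
    obtain ⟨b, hb⟩ := hP.exists_gt {a, s a} ((Set.toFinite _).lt_aleph0.le.trans hP.aleph0_le)
    exact ⟨b, a, ha, hxa, hb _ (by simp), hb _ (by simp)⟩
  choose g hg using hg
  obtain ⟨y, hyA, hyE, hyc, hyT⟩ : ∃ y ∈ A, y ∈ ladderPoints X K ∧ y ∈ closedPts g ∧
      HitsAllColors K (fun x y => h y (rung c x y)) g y := by
    by_contra! h'
    exact hA ⟨g, h'⟩
  obtain ⟨b, hb, hb'⟩ := exists_lt_rung hP hc hyE ε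
  obtain ⟨w, hwE, hwc, hbw, hwy, hwn⟩ := hyT n b hb
  obtain ⟨b', hb'w, hb''⟩ := exists_rung_eq hP hc hyE hwE hwy
  obtain ⟨x, hxA, hbx, hxg, hsg⟩ := hg b'
  have hgw := hwc b' hb'w
  have hxr := hb'' x hbx.le (hxg.trans hgw)
  refine ⟨x, hxA, y, hyA, hxg.trans (hgw.trans hwy), hsg.trans (hgw.trans hwy), ?_,
    fun z hxz hzs => ?_, ?_⟩
  · rw [hxr]
    exact hb' w hbw.le hwy
  · rw [hxr]
    exact hb'' z (hbx.le.trans hxz) (hzs.trans_lt (hsg.trans hgw))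
  · simpa only [hxr] using hwn

theorem exists_hitsAllColors (hP : IsSuccPair X K) (hQK : #Q < #K)
    (hQ : ∀ q : Q, #(Iic q → Bool) < #K) (hr : Function.Injective r) (hc : IsLadderSystem c) :
    ∃ h : X → K → ℕ, ladderPoints X K ∉
      avoidingSets K (HitsAllColors K fun x y => h y (rung c x y)) := by
  obtain ⟨z, hz⟩ := exists_splitLevels_infinite hP hQK hQ hr hc
  obtain ⟨h, hh⟩ := exists_coloring_splitLevels hP hQK hz
  refine ⟨fun y k => h y (firstDiff r k z), fun ⟨g, hg⟩ => ?_⟩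
  obtain ⟨y, hyE, hyc, hy⟩ := hh g
  refine hg y hyE hyE hyc fun n b hb => ?_
  obtain ⟨q, hq, hqn⟩ := hy n
  obtain ⟨x, hxE, hxc, hbx, hxy, hxq⟩ := hq b hb
  exact ⟨x, hxE, hxc, hbx, hxy, by simp only [hxq, hqn]⟩

end NotStrongLimit

theorem mk_fun_bool (Y : Type v) : #(Y → Bool) = 2 ^ #Y := by simp

/-! ### Existence of the coloring, by cases. -/

section GoodColoring

variable {X K : Type v} [LinearOrder X] [LinearOrder K] [WellFoundedLT X] [WellFoundedLT K]

omit [WellFoundedLT X] [WellFoundedLT K] in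
/-- If `#K ≤ 2 ^ κ` for some `κ < #K`, then there are `#K` distinct binary sequences of a common
length less than `#K` whose levels of initial segments are smaller than `#K`. -/
theorem exists_injective_of_le_two_power (hP : IsSuccPair X K) {κ : Cardinal.{v}} (hκ : κ < #K)
    (h : #K ≤ 2 ^ κ) : ∃ (Q : Type v) (_ : LinearOrder Q) (_ : WellFoundedLT Q) (_ : Nonempty Q),
      #Q < #K ∧ (∀ q : Q, #(Iic q → Bool) < #K) ∧ ∃ r : K → Q → Bool, Function.Injective r := by
  -- The least such exponent: proper initial segments of `κ₀` then carry fewer than `#K` binary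
  -- sequences.
  let κ₀ := wellFounded_lt.min {κ : Cardinal.{v} | #K ≤ 2 ^ κ} ⟨κ, h⟩
  have hκ₀ : #K ≤ 2 ^ κ₀ := wellFounded_lt.min_mem {κ : Cardinal.{v} | #K ≤ 2 ^ κ} ⟨κ, h⟩
  have hmin : ∀ κ' < κ₀, 2 ^ κ' < #K := fun κ' h' => by
    by_contra! hle
    exact wellFounded_lt.not_lt_min {κ : Cardinal.{v} | #K ≤ 2 ^ κ} hle h'
  have hle : κ₀ ≤ κ := by
    by_contra! hlt
    exact (hmin κ hlt).not_ge h
  have hinf : ℵ₀ ≤ κ₀ := by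
    by_contra! hlt
    exact (hP.aleph0_le.trans hκ₀).not_gt (power_lt_aleph0 (natCast_lt_aleph0) hlt)
  refine ⟨κ₀.ord.ToType, inferInstance, inferInstance, ?_, ?_, fun q => ?_, ?_⟩
  · rw [← mk_ne_zero_iff, mk_ord_toType]
    exact (aleph0_pos.trans_le hinf).ne'
  · rw [mk_ord_toType]
    exact hle.trans_lt hκ
  · rw [mk_fun_bool]
    refine hmin _ ?_
    rw [← Iio_insert]
    exact mk_insert_le.trans_lt
      (add_lt_of_lt hinf ((mk_Iio_lt q (by simp)).trans_eq (mk_ord_toType _)) (one_lt_aleph0.trans_le hinf))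
  · have : #K ≤ #(κ₀.ord.ToType → Bool) := by rwa [mk_fun_bool, mk_ord_toType]
    obtain ⟨r⟩ := this
    exact ⟨r, r.injective⟩

theorem exists_isGoodColoring [Nonempty K] (hP : IsSuccPair X K) (hX : #X ≤ 2 ^ #K) :
    ∃ (T : (X → X) → X → Prop) (c : X → K → X) (col : X → X → ℕ), IsLocalPred T ∧
      IsLadderSystem c ∧ IsGoodColoring T c col ∧ ladderPoints X K ∉ avoidingSets K T := by
  obtain ⟨x₀, -⟩ := hP.exists_gt ∅ (by simp)
  have : Nonempty X := ⟨x₀⟩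
  obtain ⟨c, hc⟩ := exists_isLadderSystem (X := X) (K := K)
  by_cases hpow : ∀ k : K, #(Iic k → Bool) ≤ #K
  · obtain ⟨e, he⟩ := exists_injOn_Iio hP
    obtain ⟨π, hπ⟩ := exists_stationary_partition hP
    have : #X ≤ #(K → Bool) := by rwa [mk_fun_bool]
    obtain ⟨r⟩ := this
    exact ⟨_, c, _, isLocalPred_true, hc,
      isGoodColoring_firstDiffColor hP hpow hc he r.injective hπ,
      fun h => hπ 0 (avoidingSets_mono (fun _ hx => hx.1) h)⟩
  · push Not at hpow
    obtain ⟨k, hk⟩ := hpow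
    rw [mk_fun_bool] at hk
    obtain ⟨Q, _, _, _, hQK, hQ, r, hr⟩ :=
      exists_injective_of_le_two_power hP (hP.mk_Iic_lt k) hk.le
    obtain ⟨h, hh⟩ := exists_hitsAllColors hP hQK hQ hr hc
    exact ⟨_, c, _, isLocalPred_hitsAllColors _, hc, isGoodColoring_of_hitsAllColors hP hc h, hh⟩

end GoodColoring

/-! ### Transfer to ordinals below `ν⁺`. -/

theorem mk_below (κ : Cardinal.{v}) : #(Below κ) = lift.{v + 1} κ := by
  rw [mk_Iio_ordinal, card_ord]

theorem mk_Iio_below_lt {κ : Cardinal.{v}} (x : Below κ) : #(Iio x) < lift.{v + 1} κ := by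
  refine lt_of_le_of_lt (b := #(Iio (x : Ordinal.{v}))) ?_ ?_
  · exact mk_le_of_injective (f := fun y : Iio x => (⟨y.1, y.2⟩ : Iio (x : Ordinal.{v})))
      fun y z h => Subtype.ext (Subtype.ext (Subtype.mk.inj h))
  · rw [mk_Iio_ordinal, lift_lt]
    exact lt_ord.1 x.2

theorem isSuccPair_below {ν : Cardinal.{v}} (hν : ν.IsRegular) :
    IsSuccPair (Below (Order.succ ν)) (Below ν) where
  regular := by
    rw [mk_below]
    exact hν.lift
  mk_Iio_lt k := by
    rw [mk_below]
    exact mk_Iio_below_lt k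
  mk_Iio_le x := by
    rw [mk_below, ← Order.lt_succ_iff, ← lift_succ]
    exact mk_Iio_below_lt x
  mk_lt := by
    rw [mk_below, mk_below, lift_lt]
    exact Order.lt_succ ν

/-- One inclusion suffices: the ideal is downward closed, so positivity passes to the larger set. -/
theorem ladderPoints_subset_cofSet (μ ν : Cardinal.{v}) :
    ladderPoints (Below μ) (Below ν) ⊆ cofSet μ ν := by
  rintro y ⟨⟨c, hcy, hc⟩, hy⟩
  have hlt : ∀ {o : Ordinal.{v}}, o < y → o < μ.ord := fun h => h.trans y.2
  have key : Order.cof (Iio (y : Ordinal.{v})) = lift.{v + 1} ν := by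
    apply le_antisymm
    · rw [← mk_below ν]
      refine (Order.cof_le (s := range fun i => (⟨c i, hcy i⟩ : Iio (y : Ordinal.{v})))
        fun z => ?_).trans mk_range_le
      obtain ⟨i, hi⟩ := hc ⟨z, hlt z.2⟩ z.2
      exact ⟨_, ⟨i, rfl⟩, hi⟩
    · rw [Order.le_cof_iff]
      intro s hs
      by_contra! hcard
      obtain ⟨b, hb, hsb⟩ := hy (range fun z : s => (⟨z.1, hlt z.1.2⟩ : Below μ))
        (by rintro _ ⟨z, rfl⟩; exact z.1.2) (by
          rw [mk_below]
          exact mk_range_le.trans_lt hcard)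
      obtain ⟨z, hz, hbz⟩ := hs ⟨b, hb⟩
      exact (hsb _ ⟨⟨z, hz⟩, rfl⟩).not_ge hbz
  rw [Ordinal.cof_Iio, ← Ordinal.lift_cof, lift_inj] at key
  exact key

theorem mainTheorem6 (μ ν : Cardinal.{u}) (hν : ν.IsRegular) (hμ : μ = Order.succ ν) :
    ∃ (d₀ : List (Below μ) → ℕ) (J : Order.Ideal (Set (Below μ))),
      ContainsSmallSets J ∧ IsAdditiveIdeal J ∧ IsNormalIdeal J ∧ cofSet μ ν ∉ J ∧
      ∀ (A : Set (Below μ)), A ∉ J →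
        ∀ (u v : A → Set (List (Below μ))) (σ : A → List (Below μ)), IsOscSequence ν A u v σ →
          ∃ α β : A, α < β ∧ ∀ ρ ∈ u α, ∀ τ ∈ v β, d₀ (ρ ++ τ) = ρ.length := by
  subst hμ
  have hP := isSuccPair_below hν
  have hle : ∀ {κ : Cardinal.{u + 1}}, κ < lift.{u + 1} (Order.succ ν) → κ ≤ #(Below ν) :=
    fun h => by rwa [mk_below, ← Order.lt_succ_iff, ← lift_succ]
  have hK := hP.nonempty_index
  obtain ⟨T, c, col, hT, hc, hcol, hE⟩ := exists_isGoodColoring hP (by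
    rw [mk_below, mk_below, lift_succ, Order.succ_le_iff]
    exact cantor _)
  refine ⟨cutDecode c col, (isIdeal_avoidingSets hP hT).toIdeal,
    fun B hB => small_mem_avoidingSets hP B (hle hB),
    fun S hS h => sUnion_mem_avoidingSets hP hT S (hle hS) h,
    fun A h => diagonal_mem_avoidingSets hP hT A h,
    fun h => hE (avoidingSets_mono (ladderPoints_subset_cofSet _ _) h), fun A hA u v σ h => ?_⟩
  exact exists_decoding hP hT hc hcol hA u v σ
    (fun x => (h.u_small x).trans_eq (mk_below ν).symm)
    (fun x => (h.v_small x).trans_eq (mk_below ν).symm) h.mem_of_mem_u h.prefix_of_mem_v
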